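/- \textbf{Conventions.} Let $d\ge 2$, let $\|\cdot\|$ be the Euclidean norm, and for $z\in\mathbb Z^d$ let $C_z=z+[-\tfrac12,\tfrac12]^d$. For a finite set $A\subset\mathbb Z^d$ put $\square A=\bigcup_{z\in A}C_z$, let $\partial A=\{y\in\mathbb Z^d\setminus A:\ \|x-y\|=1\text{ for some }x\in A\}$ be its outer boundary, and for $A\neq\emptyset$ let $\operatorname{rad}(A)=\max_{x\in A}\|x\|$. \textbf{Isotropic random lines.} Let $A(d,1)$ be the space of lines in $\mathbb R^d$ with the $\sigma$-algebra generated by the sets $[K]=\{L: L\cap K\ne\emptyset\}$, $K\subset\mathbb R^d$ compact and convex. Let $\mu_1$ be the measure on $A(d,1)$ that is invariant under Euclidean motions, normalized so that the set of lines hitting the unit ball of $\mathbb R^d$ has measure equal to the volume of the unit ball of $\mathbb R^{d-1}$; explicitly, $$\mu_1(\mathcal A)=\int_{\mathbb S^{d-1}}\lambda_{u^\perp}\big(\{x\in u^\perp:\ x+\mathbb R u\in\mathcal A\}\big)\,\sigma(du),$$ where $\sigma$ is the uniform probability measure on the sphere and $\lambda_{u^\perp}$ is Lebesgue measure on the hyperplane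 $u^\perp$. For a nonempty finite $A\subset\mathbb Z^d$ let $\mathbb P^{\square A}(\mathcal A)=\mu_1(\mathcal A\cap[\square A])/\mu_1([\square A])$ be the distribution of an isotropic random line through $\square A$. \textbf{Ballistic measures.} For each line $L$ let $v_L$ be its unit direction vector whose first nonzero coordinate is positive, and let $L^A=\{z\in A: C_z\cap L\neq\emptyset\}$, ordered by the position at which $L$, traversed in direction $v_L$, enters the box $C_z$ (ties being broken by the lexicographic order of $\mathbb Z^d$; they do not matter for $\mu_1$-almost every $L$). Let $\min(L^A)$ and $\max(L^A)$ be the first and the last element in this order. Set $b_A(z,L)=1$ if $L^A=\{z\}$, $b_A(z,L)=\frac12$ if $\#(L^A)>1$ and $z\in\{\min(L^A),\max(L^A)\}$, and $b_A(z,L)=0$ otherwise. The ballistic measure on $A$ is given by $$b_A(z)=\int_{A(d,1)} b_A(z,L)\,\mathbb P^{\square A}(dL),\qquad z\in\mathbb Z^d .$$ \textbf{Ballistic aggregation} in $\mathbb Z^d$ is a sequence $(F_n)_{n\ge1}$ of random finite subsets of $\mathbb Z^d$ on a probability space such that $F_1=\{0\}$ and, for every $n\ge 1$, $F_{n+1}=F_n\cup\{y_{n+1}\}$,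 where $y_{n+1}$ is a random point of $\mathbb Z^d$ whose conditional distribution given $F_n$ is $b_{\partial F_n}$; that is, $\mathbb P(y_{n+1}=z\mid F_n=A)=b_{\partial A}(z)$ for every $z\in\mathbb Z^d$ and every finite $A\subset\mathbb Z^d$ with $\mathbb P(F_n=A)>0$. \textbf{Theorem.} For every $d\ge2$ there is a constant $c>0$, depending only on $d$, such that every ballistic aggregation $(F_n)_{n\ge1}$ in $\mathbb Z^d$ satisfies, almost surely, $$\operatorname{rad}(F_n)\le c\,n^{1/2}\qquad\text{for all sufficiently large } n .$$ -/

import Mathlib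

open MeasureTheory Set
open scoped ENNReal NNReal

noncomputable section

namespace BallisticAggregation

/-! ### Lattice points, clusters and their boundaries -/

/-- The Euclidean space `ℝ^d`. -/
abbrev Space (d : ℕ) : Type := EuclideanSpace ℝ (Fin d)

/-- The lattice `ℤ^d`. -/
abbrev Lattice (d : ℕ) : Type := Fin d → ℤ

/-- The natural embedding of `ℤ^d` into `ℝ^d`. -/
def emb {d : ℕ} (z : Lattice d) : Space d := WithLp.toLp 2 (fun i => (z i : ℝ))

/-- The outer boundary of `A` in the nearest neighbour graph, as a set: all lattice points outside
`A` at Euclidean distance `1` from some point of `A`. -/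
def outerBoundarySet {d : ℕ} (A : Finset (Lattice d)) : Set (Lattice d) :=
  {y | y ∉ A ∧ ∃ x ∈ A, ‖emb x - emb y‖ = 1}

theorem outerBoundarySet_finite {d : ℕ} (A : Finset (Lattice d)) :
    (outerBoundarySet A).Finite := by
  have hsub : outerBoundarySet A ⊆ ⋃ x ∈ A, Set.Icc (x - 1) (x + 1) := by
    rintro y ⟨-, x, hx, hxy⟩
    have key : ∀ i, |x i - y i| ≤ 1 := by
      intro i
      have h := PiLp.norm_apply_le (emb x - emb y) i
      rw [hxy, Real.norm_eq_abs] at h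
      simp only [emb, PiLp.sub_apply] at h
      exact_mod_cast h
    refine Set.mem_biUnion hx ⟨fun i => ?_, fun i => ?_⟩
    · have := (abs_le.1 (key i)).2
      simp only [Pi.sub_apply, Pi.one_apply]
      omega
    · have := (abs_le.1 (key i)).1
      simp only [Pi.add_apply, Pi.one_apply]
      omega
  exact (A.finite_toSet.biUnion fun x _ => Set.finite_Icc (x - 1) (x + 1)).subset hsub

/-- The outer boundary `∂A` as a finite set. -/
def outerBoundary {d : ℕ} (A : Finset (Lattice d)) : Finset (Lattice d) :=
  (outerBoundarySet_finite A).toFinset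

/-- The radius `max_{x ∈ A} ‖x‖` of a nonempty finite set `A` of lattice points. -/
def rad {d : ℕ} (A : Finset (Lattice d)) : ℝ :=
  ((A.sup fun x => ‖emb x‖₊ : ℝ≥0) : ℝ)

/-! ### Incremental aggregation -/

/-- `F 1, F 2, …` is incremental aggregation on the probability space `(Ω, P)` for the family
`m` of distributions, `m A z` being the mass which the distribution with index `A` gives to `z`.
(The value `F 0` plays no role.) -/
structure IsIncrementalAggregation {d : ℕ} (m : Finset (Lattice d) → Lattice d → ℝ≥0∞)
    {Ω : Type*} [MeasurableSpace Ω] (P : Measure Ω) (F : ℕ → Ω → Finset (Lattice d)) : Prop where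
  /-- Each `F n` is a random finite set (for the discrete σ-algebra on finite sets). -/
  measurable : ∀ n, 1 ≤ n → Measurable[_, ⊤] (F n)
  /-- The cluster starts with the single point `0`. -/
  start : ∀ ω, F 1 ω = {0}
  /-- `F (n + 1)` arises from `F n` by adding a random point, whose conditional distribution given
  `F n` is the one with index `∂ (F n)`. -/
  step : ∀ n, 1 ≤ n → ∃ y : Ω → Lattice d, Measurable y ∧
    (∀ ω, F (n + 1) ω = F n ω ∪ {y ω}) ∧
    ∀ A : Finset (Lattice d), P {ω | F n ω = A} ≠ 0 →
      ∀ z, ProbabilityTheory.cond P {ω | F n ω = A} {ω | y ω = z} = m (outerBoundary A) z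

/-! ### The invariant measure on the space of lines -/

/-- The space `A(d,1)` of lines in `ℝ^d`. -/
def Line (d : ℕ) : Type :=
  {L : AffineSubspace ℝ (Space d) // Module.finrank ℝ L.direction = 1}

/-- The set of points of a line. -/
def Line.pts {d : ℕ} (L : Line d) : Set (Space d) := (L.1 : Set (Space d))

/-- The set `[K]` of all lines that hit `K`. -/
def hit {d : ℕ} (K : Set (Space d)) : Set (Line d) := {L | (L.pts ∩ K).Nonempty}

/-- The σ-algebra on the space of lines, generated by the sets `[K]`, `K` a convex body. -/
instance Line.measurableSpace (d : ℕ) : MeasurableSpace (Line d) :=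
  MeasurableSpace.generateFrom {S | ∃ K : Set (Space d), IsCompact K ∧ Convex ℝ K ∧ S = hit K}

/-- The unit sphere of `ℝ^d`. -/
abbrev UnitSphere (d : ℕ) : Type := Metric.sphere (0 : Space d) 1

/-- The line through `x` with direction `u`. -/
def lineThrough {d : ℕ} (u : UnitSphere d) (x : Space d) : Line d :=
  ⟨AffineSubspace.mk' x (Submodule.span ℝ {(u : Space d)}), by
    rw [AffineSubspace.direction_mk']
    exact finrank_span_singleton (ne_zero_of_mem_unit_sphere u)⟩

theorem mem_lineThrough {d : ℕ} (u : UnitSphere d) (x y : Space d) :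
    y ∈ (lineThrough u x).pts ↔ ∃ t : ℝ, y = x + t • (u : Space d) := by
  simp only [lineThrough, Line.pts, SetLike.mem_coe, AffineSubspace.mem_mk', vsub_eq_sub,
    Submodule.mem_span_singleton]
  constructor
  · rintro ⟨t, ht⟩
    exact ⟨t, by rw [ht]; abel⟩
  · rintro ⟨t, rfl⟩
    exact ⟨t, by abel⟩

theorem lineThrough_add_smul {d : ℕ} (u : UnitSphere d) (x : Space d) (t : ℝ) :
    lineThrough u (x + t • (u : Space d)) = lineThrough u x := by
  refine Subtype.ext (SetLike.coe_injective ?_)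
  ext y
  change y ∈ (lineThrough u _).pts ↔ y ∈ (lineThrough u x).pts
  rw [mem_lineThrough, mem_lineThrough]
  constructor
  · rintro ⟨r, rfl⟩
    exact ⟨t + r, by rw [add_smul, add_assoc]⟩
  · rintro ⟨r, rfl⟩
    exact ⟨r - t, by rw [sub_smul]; abel⟩

theorem measurable_lineThrough (d : ℕ) :
    Measurable (fun p : UnitSphere d × Space d => lineThrough p.1 p.2) := by
  refine measurable_generateFrom ?_
  rintro _ ⟨K, hK, -, rfl⟩
  have hcpt : CompactSpace K := isCompact_iff_compactSpace.1 hK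
  have hcl : IsClosed {q : K × (UnitSphere d × Space d) | (q.1 : Space d) - q.2.2 =
      inner ℝ (q.2.1 : Space d) ((q.1 : Space d) - q.2.2) • (q.2.1 : Space d)} :=
    isClosed_eq (by fun_prop) (by fun_prop)
  have himg := isClosedMap_snd_of_compactSpace _ hcl
  convert himg.measurableSet using 1
  ext ⟨u, x⟩
  have hu : inner ℝ (u : Space d) (u : Space d) = 1 := by
    rw [real_inner_self_eq_norm_sq, norm_eq_of_mem_sphere u, one_pow]
  constructor
  · rintro ⟨k, hk, hkK⟩
    obtain ⟨t, rfl⟩ := (mem_lineThrough u x k).1 hk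
    refine ⟨(⟨_, hkK⟩, (u, x)), ?_, rfl⟩
    simp only [mem_ofPred_eq, add_sub_cancel_left, inner_smul_right, hu, mul_one]
  · rintro ⟨⟨k, v, y⟩, hq, hvy⟩
    obtain ⟨rfl, rfl⟩ := Prod.mk.inj hvy
    exact ⟨k, (mem_lineThrough _ _ _).2 ⟨_, (sub_eq_iff_eq_add'.1 hq)⟩, k.2⟩

/-- The uniform distribution on the unit sphere. -/
def sphereUniform (d : ℕ) : Measure (UnitSphere d) :=
  ((volume : Measure (Space d)).toSphere univ)⁻¹ • (volume : Measure (Space d)).toSphere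

/-- The measure on the lines with a given direction `u`, identified with their base points in the
hyperplane `u^⊥`, which carries its `(d-1)`-dimensional Lebesgue measure. -/
def parallelMeasure {d : ℕ} (u : UnitSphere d) : Measure (Line d) :=
  (volume : Measure (Submodule.span ℝ {(u : Space d)})ᗮ).map
    fun x : (Submodule.span ℝ {(u : Space d)})ᗮ => lineThrough u (x : Space d)

theorem measurable_lineThrough_right {d : ℕ} (u : UnitSphere d) :
    Measurable (fun x : Space d => lineThrough u x) := by
  have h : Measurable fun x : Space d => ((u, x) : UnitSphere d × Space d) :=
    measurable_const.prodMk measurable_id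
  intro s hs
  exact h (measurable_lineThrough d hs)

/-- The measure `parallelMeasure u` through the volume of a slab of width one orthogonal to `u`. -/
theorem parallelMeasure_apply_slab {d : ℕ} (u : UnitSphere d) {s : Set (Line d)}
    (hs : MeasurableSet s) :
    parallelMeasure u s = (volume : Measure (Space d))
      {y | inner ℝ (u : Space d) y ∈ Icc (0 : ℝ) 1 ∧ lineThrough u y ∈ s} := by
  have hu : ‖(u : Space d)‖ = 1 := norm_eq_of_mem_sphere u
  set S := Submodule.span ℝ {(u : Space d)} with hS
  have hml : Measurable fun x : Sᗮ => lineThrough u (x : Space d) :=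
    (measurable_lineThrough_right u).comp measurable_subtype_coe
  have hΦ : MeasurePreserving (fun y : Space d => WithLp.ofLp (S.orthogonalDecomposition y)) :=
    (WithLp.volume_preserving_ofLp _ _).comp S.orthogonalDecomposition.measurePreserving
  have hI : MeasurableSet {a : S | inner ℝ (u : Space d) (a : Space d) ∈ Icc (0 : ℝ) 1} :=
    measurableSet_Icc.preimage (by fun_prop)
  have hvol : volume {a : S | inner ℝ (u : Space d) (a : Space d) ∈ Icc (0 : ℝ) 1} = 1 := by
    have hpre := (LinearIsometryEquiv.toSpanUnitSingleton (𝕜 := ℝ) (u : Space d) hu).measurePreserving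
    rw [← hpre.measure_preimage hI.nullMeasurableSet]
    have : (LinearIsometryEquiv.toSpanUnitSingleton (𝕜 := ℝ) (u : Space d) hu) ⁻¹'
        {a : S | inner ℝ (u : Space d) (a : Space d) ∈ Icc (0 : ℝ) 1} = Icc 0 1 := by
      ext t
      rw [mem_preimage, mem_ofPred_eq, LinearIsometryEquiv.toSpanUnitSingleton_apply,
        inner_smul_right, real_inner_self_eq_norm_sq, hu, one_pow, mul_one]
    rw [this]
    simp
  have hset : {y : Space d | inner ℝ (u : Space d) y ∈ Icc (0 : ℝ) 1 ∧ lineThrough u y ∈ s} =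
      (fun y : Space d => WithLp.ofLp (S.orthogonalDecomposition y)) ⁻¹'
        ({a : S | inner ℝ (u : Space d) (a : Space d) ∈ Icc (0 : ℝ) 1} ×ˢ
          ((fun x : Sᗮ => lineThrough u (x : Space d)) ⁻¹' s)) := by
    ext y
    rw [mem_preimage, S.orthogonalDecomposition_apply, mem_prod, mem_preimage, mem_ofPred_eq,
      mem_ofPred_eq]
    obtain ⟨t, ht⟩ := Submodule.mem_span_singleton.1 (S.orthogonalProjectionOnto y).2
    have hy : y = (Sᗮ.orthogonalProjectionOnto y : Space d) + t • (u : Space d) := by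
      have h := S.starProjection_add_starProjection_orthogonal y
      rw [Submodule.starProjection_apply, Submodule.starProjection_apply] at h
      rw [ht, add_comm]
      exact h.symm
    have h1 : inner ℝ (u : Space d) y =
        inner ℝ (u : Space d) (S.orthogonalProjectionOnto y : Space d) := by
      conv_lhs => rw [hy]
      rw [inner_add_right, ht, (Submodule.mem_orthogonal S _).1 (Sᗮ.orthogonalProjectionOnto y).2
        (u : Space d) (Submodule.mem_span_singleton_self _), zero_add]
    have h2 : lineThrough u y = lineThrough u (Sᗮ.orthogonalProjectionOnto y : Space d) := by
      conv_lhs => rw [hy]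
      exact lineThrough_add_smul u _ t
    rw [h1, h2]
  rw [hset, hΦ.measure_preimage (hI.prod (hml hs)).nullMeasurableSet, Measure.volume_eq_prod,
    Measure.prod_prod, hvol, one_mul, parallelMeasure, Measure.map_apply hml hs]

theorem measurable_parallelMeasure (d : ℕ) :
    Measurable (parallelMeasure : UnitSphere d → Measure (Line d)) := by
  refine Measure.measurable_of_measurable_coe _ fun s hs => ?_
  simp_rw [parallelMeasure_apply_slab _ hs]
  have hT : MeasurableSet {p : UnitSphere d × Space d |
      inner ℝ (p.1 : Space d) p.2 ∈ Icc (0 : ℝ) 1 ∧ lineThrough p.1 p.2 ∈ s} :=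
    (measurableSet_Icc.preimage (by fun_prop)).inter ((measurable_lineThrough d) hs)
  exact measurable_measure_prodMk_left hT

/-- The invariant measure `μ₁` on the space of lines: choose the direction uniformly on the sphere
and integrate over the lines with this direction. -/
def lineMeasure (d : ℕ) : Measure (Line d) :=
  (sphereUniform d).bind parallelMeasure

theorem lineMeasure_apply {d : ℕ} {s : Set (Line d)} (hs : MeasurableSet s) :
    lineMeasure d s = ∫⁻ u : UnitSphere d, volume
      {x : (Submodule.span ℝ {(u : Space d)})ᗮ | lineThrough u (x : Space d) ∈ s}
      ∂(sphereUniform d) := by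
  rw [lineMeasure, Measure.bind_apply hs (measurable_parallelMeasure d).aemeasurable]
  refine lintegral_congr fun u => ?_
  have hml : Measurable fun x : (Submodule.span ℝ {(u : Space d)})ᗮ => lineThrough u (x : Space d) :=
    (measurable_lineThrough_right u).comp measurable_subtype_coe
  rw [parallelMeasure, Measure.map_apply hml hs]
  rfl

/-- The image of a line under a Euclidean motion. -/
def Line.map {d : ℕ} (g : Space d ≃ᵃⁱ[ℝ] Space d) (L : Line d) : Line d :=
  ⟨L.1.map (g.toAffineEquiv : Space d →ᵃ[ℝ] Space d), by
    rw [AffineSubspace.map_direction]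
    exact (LinearEquiv.finrank_map_eq g.linearIsometryEquiv.toLinearEquiv L.1.direction).trans L.2⟩

theorem Line.pts_map {d : ℕ} (g : Space d ≃ᵃⁱ[ℝ] Space d) (L : Line d) :
    (L.map g).pts = g '' L.pts :=
  AffineSubspace.coe_map _ _

theorem Line.measurable_map {d : ℕ} (g : Space d ≃ᵃⁱ[ℝ] Space d) :
    Measurable (Line.map g) := by
  refine measurable_generateFrom ?_
  rintro _ ⟨K, hK, hKc, rfl⟩
  refine MeasurableSpace.measurableSet_generateFrom ⟨g ⁻¹' K, ?_, ?_, ?_⟩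
  · exact g.toHomeomorph.isCompact_preimage.2 hK
  · exact hKc.affine_preimage (g.toAffineEquiv : Space d →ᵃ[ℝ] Space d)
  · ext L
    rw [mem_preimage, hit, hit, mem_ofPred_eq, mem_ofPred_eq, Line.pts_map,
      image_inter_nonempty_iff]

instance (d : ℕ) [NeZero d] : IsProbabilityMeasure (sphereUniform d) := by
  have : Nonempty (Fin d) := ⟨0⟩
  have h0 : (volume : Measure (Space d)).toSphere ≠ 0 := Measure.toSphere_ne_zero _
  exact ⟨ENNReal.inv_mul_cancel (Measure.measure_univ_ne_zero.2 h0) (measure_ne_top _ _)⟩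

/-- The action of a linear isometry on the unit sphere. -/
def rotate {d : ℕ} (R : Space d ≃ₗᵢ[ℝ] Space d) (u : UnitSphere d) : UnitSphere d :=
  ⟨R u, by rw [mem_sphere_zero_iff_norm, R.norm_map, norm_eq_of_mem_sphere]⟩

theorem measurePreserving_rotate {d : ℕ} (R : Space d ≃ₗᵢ[ℝ] Space d) :
    MeasurePreserving (rotate R) (sphereUniform d) (sphereUniform d) := by
  have hc : Continuous (rotate R) :=
    Continuous.subtype_mk (R.continuous.comp continuous_subtype_val) _
  refine MeasurePreserving.smul_measure ⟨hc.measurable, ?_⟩ _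
  ext s hs
  rw [Measure.map_apply hc.measurable hs, Measure.toSphere_apply' _ hs,
    Measure.toSphere_apply' _ (hc.measurable hs)]
  congr 1
  have hR : MeasurePreserving R.toMeasurableEquiv (volume : Measure (Space d)) volume :=
    R.measurePreserving
  refine Eq.trans ?_ (hR.measure_preimage_equiv _)
  congr 1
  ext x
  simp only [mem_preimage, mem_smul, mem_image]
  constructor
  · rintro ⟨r, hr, _, ⟨u, hu, rfl⟩, rfl⟩
    exact ⟨r, hr, _, ⟨_, hu, rfl⟩, (R.map_smul r (u : Space d)).symm⟩
  · rintro ⟨r, hr, _, ⟨u, hu, rfl⟩, hx⟩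
    have hru : rotate R (rotate R.symm u) = u := Subtype.ext (R.apply_symm_apply _)
    refine ⟨r, hr, _, ⟨rotate R.symm u, by rwa [hru], rfl⟩, R.injective ?_⟩
    rw [R.map_smul]
    exact (congrArg (fun v : UnitSphere d => r • (v : Space d)) hru).trans hx

theorem lineMeasure_apply_slab {d : ℕ} {s : Set (Line d)} (hs : MeasurableSet s) :
    lineMeasure d s = ∫⁻ u : UnitSphere d, (volume : Measure (Space d))
      {y | inner ℝ (u : Space d) y ∈ Icc (0 : ℝ) 1 ∧ lineThrough u y ∈ s} ∂(sphereUniform d) := by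
  rw [lineMeasure, Measure.bind_apply hs (measurable_parallelMeasure d).aemeasurable]
  exact lintegral_congr fun u => parallelMeasure_apply_slab u hs

/-- The measure `lineMeasure` is invariant under Euclidean motions. -/
theorem lineMeasure_map {d : ℕ} (g : Space d ≃ᵃⁱ[ℝ] Space d) :
    (lineMeasure d).map (Line.map g) = lineMeasure d := by
  set R := g.linearIsometryEquiv
  have hg : ∀ y, g y = R y + g 0 := fun y => by
    simpa using g.map_vadd 0 y
  ext s hs
  have hline : ∀ (u : UnitSphere d) (y : Space d),
      Line.map g (lineThrough u y) = lineThrough (rotate R u) (R y + g 0) := by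
    intro u y
    refine Subtype.ext (SetLike.coe_injective ?_)
    ext z
    change z ∈ (Line.map g (lineThrough u y)).pts ↔ z ∈ (lineThrough (rotate R u) _).pts
    rw [Line.pts_map, mem_lineThrough]
    constructor
    · rintro ⟨w, hw, rfl⟩
      obtain ⟨t, rfl⟩ := (mem_lineThrough _ _ _).1 hw
      exact ⟨t, by rw [hg, map_add, map_smul, rotate]; abel⟩
    · rintro ⟨t, rfl⟩
      exact ⟨_, (mem_lineThrough _ _ _).2 ⟨t, rfl⟩, by rw [hg, map_add, map_smul, rotate]; abel⟩
  have hF : Measurable fun u : UnitSphere d => (volume : Measure (Space d))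
      {y | inner ℝ (u : Space d) y ∈ Icc (0 : ℝ) 1 ∧ lineThrough u y ∈ s} := by
    simp_rw [← parallelMeasure_apply_slab _ hs]
    exact (Measure.measurable_coe hs).comp (measurable_parallelMeasure d)
  rw [Measure.map_apply (Line.measurable_map g) hs,
    lineMeasure_apply_slab (Line.measurable_map g hs), lineMeasure_apply_slab hs,
    ← (measurePreserving_rotate R).lintegral_comp hF]
  refine lintegral_congr fun u => ?_
  have hv : inner ℝ (rotate R u : Space d) (rotate R u : Space d) = 1 := by
    rw [real_inner_self_eq_norm_sq, norm_eq_of_mem_sphere, one_pow]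
  have hT : MeasurableSet
      {y | inner ℝ (rotate R u : Space d) y ∈ Icc (0 : ℝ) 1 ∧ lineThrough (rotate R u) y ∈ s} :=
    (measurableSet_Icc.preimage (by fun_prop)).inter (measurable_lineThrough_right (rotate R u) hs)
  have hmp : MeasurePreserving (fun y : Space d =>
      R y + (g 0 - inner ℝ (rotate R u : Space d) (g 0) • (rotate R u : Space d))) :=
    (measurePreserving_add_right volume _).comp R.measurePreserving
  rw [← hmp.measure_preimage hT.nullMeasurableSet]
  congr 1
  ext y
  have h1 : inner ℝ (rotate R u : Space d)
      (R y + (g 0 - inner ℝ (rotate R u : Space d) (g 0) • (rotate R u : Space d))) =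
      inner ℝ (u : Space d) y := by
    rw [inner_add_right, inner_sub_right, inner_smul_right, hv, mul_one, sub_self, add_zero]
    exact R.inner_map_map _ _
  have h2 : lineThrough (rotate R u)
      (R y + (g 0 - inner ℝ (rotate R u : Space d) (g 0) • (rotate R u : Space d))) =
      Line.map g (lineThrough u y) := by
    rw [hline, ← lineThrough_add_smul (rotate R u) _ (inner ℝ (rotate R u : Space d) (g 0))]
    congr 1
    abel
  rw [mem_preimage, mem_ofPred_eq, mem_ofPred_eq, h1, h2, mem_preimage]

/-- The measure of the set of lines that hit the unit ball is the volume of the unit ball of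
`ℝ^(d-1)`. -/
theorem lineMeasure_unitBall (d : ℕ) :
    lineMeasure (d + 1) (hit (Metric.closedBall 0 1)) =
      (volume : Measure (Space d)) (Metric.closedBall 0 1) := by
  have hm : MeasurableSet (hit (Metric.closedBall (0 : Space (d + 1)) 1)) :=
    MeasurableSpace.measurableSet_generateFrom
      ⟨_, isCompact_closedBall 0 1, convex_closedBall 0 1, rfl⟩
  rw [lineMeasure_apply hm]
  have key : ∀ u : UnitSphere (d + 1), volume {x : (Submodule.span ℝ {(u : Space (d + 1))})ᗮ |
      lineThrough u (x : Space (d + 1)) ∈ hit (Metric.closedBall (0 : Space (d + 1)) 1)} =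
      (volume : Measure (Space d)) (Metric.closedBall 0 1) := by
    intro u
    have hfin : Module.finrank ℝ (Submodule.span ℝ {(u : Space (d + 1))})ᗮ = d := by
      have h1 := Submodule.finrank_add_finrank_orthogonal (Submodule.span ℝ {(u : Space (d + 1))})
      rw [finrank_span_singleton (ne_zero_of_mem_unit_sphere u), finrank_euclideanSpace_fin] at h1
      omega
    let e : (Submodule.span ℝ {(u : Space (d + 1))})ᗮ ≃ₗᵢ[ℝ] Space d :=
      ((stdOrthonormalBasis ℝ _).reindex (finCongr hfin)).repr
    rw [← e.measurePreserving.measure_preimage Metric.isClosed_closedBall.nullMeasurableSet]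
    congr 1
    ext x
    have hxu : inner ℝ (x : Space (d + 1)) (u : Space (d + 1)) = 0 := by
      rw [real_inner_comm]
      exact (Submodule.mem_orthogonal _ _).1 x.2 _ (Submodule.mem_span_singleton_self _)
    rw [mem_ofPred_eq, mem_preimage, mem_closedBall_zero_iff, e.norm_map]
    constructor
    · rintro ⟨y, hy, hyb⟩
      obtain ⟨t, rfl⟩ := (mem_lineThrough _ _ _).1 hy
      rw [mem_closedBall_zero_iff] at hyb
      have h := norm_add_sq_eq_norm_sq_add_norm_sq_real
        (x := (x : Space (d + 1))) (y := t • (u : Space (d + 1)))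
        (by rw [inner_smul_right, hxu, mul_zero])
      have hx : ‖x‖ = ‖(x : Space (d + 1))‖ := rfl
      rw [hx]
      nlinarith [norm_nonneg ((x : Space (d + 1)) + t • (u : Space (d + 1))),
        norm_nonneg (x : Space (d + 1)), norm_nonneg (t • (u : Space (d + 1)))]
    · intro hx
      exact ⟨x, (mem_lineThrough _ _ _).2 ⟨0, by simp⟩, mem_closedBall_zero_iff.2 hx⟩
  simp_rw [key]
  rw [lintegral_const, measure_univ, mul_one]

/-! ### The ballistic measures -/

/-- The grid box `C_z = z + [-1/2, 1/2]^d`. -/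
def box {d : ℕ} (z : Lattice d) : Set (Space d) := {x | ∀ i, |x i - z i| ≤ 1 / 2}

/-- The union `□A` of the grid boxes centered in `A`. -/
def boxes {d : ℕ} (A : Finset (Lattice d)) : Set (Space d) := ⋃ z ∈ A, box z

/-- The distribution of an isotropic random line through `K`: the conditional measure
`μ₁(· ∩ [K]) / μ₁([K])`. -/
def isotropicLine {d : ℕ} (K : Set (Space d)) : Measure (Line d) :=
  ProbabilityTheory.cond (lineMeasure d) (hit K)

/-- Every line has a unit direction vector whose first nonzero coordinate is positive. -/
theorem Line.exists_direction {d : ℕ} (L : Line d) : ∃ v : Space d, v ∈ L.1.direction ∧ ‖v‖ = 1 ∧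
    ∃ i, 0 < v i ∧ ∀ j < i, v j = 0 := by
  obtain ⟨w, hw0, -⟩ := finrank_eq_one_iff'.1 L.2
  have hw1 : (w : Space d) ≠ 0 := fun h => hw0 (Subtype.ext h)
  obtain ⟨i, hi, hmin⟩ : ∃ i, (w : Space d) i ≠ 0 ∧ ∀ j < i, (w : Space d) j = 0 := by
    have hex : ∃ i, (w : Space d) i ≠ 0 := by
      by_contra! h
      exact hw1 (PiLp.ext h)
    obtain ⟨i, hi, hmin⟩ := (Set.toFinite {i | (w : Space d) i ≠ 0}).exists_minimal hex
    refine ⟨i, hi, fun j hj => ?_⟩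
    by_contra hne
    exact absurd (hmin hne hj.le) (not_le.2 hj)
  have hn : 0 < ‖(w : Space d)‖ := norm_pos_iff.2 hw1
  rcases lt_or_gt_of_ne hi with h | h
  · refine ⟨(-‖(w : Space d)‖⁻¹) • (w : Space d), Submodule.smul_mem _ _ w.2, ?_, i, ?_, ?_⟩
    · rw [norm_smul, norm_neg, norm_inv, norm_norm, inv_mul_cancel₀ hn.ne']
    · exact mul_pos_of_neg_of_neg (neg_lt_zero.2 (inv_pos.2 hn)) h
    · intro j hj
      rw [PiLp.smul_apply, hmin j hj, smul_zero]
  · refine ⟨‖(w : Space d)‖⁻¹ • (w : Space d), Submodule.smul_mem _ _ w.2, ?_, i, ?_, ?_⟩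
    · rw [norm_smul, norm_inv, norm_norm, inv_mul_cancel₀ hn.ne']
    · exact mul_pos (inv_pos.2 hn) h
    · intro j hj
      rw [PiLp.smul_apply, hmin j hj, smul_zero]

/-- The direction `v_L` in which the line `L` is traversed: its unit direction vector whose first
nonzero coordinate is positive. -/
def Line.dir {d : ℕ} (L : Line d) : Space d := L.exists_direction.choose

open scoped Classical in
/-- The set `L^A` of the points of `A` whose boxes are hit by the line `L`. -/
def visited {d : ℕ} (A : Finset (Lattice d)) (L : Line d) : Finset (Lattice d) :=
  A.filter fun z => (L.pts ∩ box z).Nonempty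

/-- The position, along `L` traversed in direction `v_L`, at which `L` enters the box `C_z`. -/
def entry {d : ℕ} (L : Line d) (z : Lattice d) : ℝ :=
  sInf ((fun x => inner ℝ L.dir x) '' (L.pts ∩ box z))

/-- The order in which `L` visits boxes: by the position of entry, ties being broken by the
lexicographic order of `ℤ^d`. -/
def visitKey {d : ℕ} (L : Line d) (z : Lattice d) : ℝ ×ₗ Lex (Lattice d) :=
  toLex (entry L z, toLex z)

/-- `z = min (L^A)`. -/
def IsFirst {d : ℕ} (A : Finset (Lattice d)) (L : Line d) (z : Lattice d) : Prop :=
  z ∈ visited A L ∧ ∀ w ∈ visited A L, visitKey L z ≤ visitKey L w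

/-- `z = max (L^A)`. -/
def IsLast {d : ℕ} (A : Finset (Lattice d)) (L : Line d) (z : Lattice d) : Prop :=
  z ∈ visited A L ∧ ∀ w ∈ visited A L, visitKey L w ≤ visitKey L z

open scoped Classical in
/-- The number `b_A(z, L)`. -/
def lineWeight {d : ℕ} (A : Finset (Lattice d)) (z : Lattice d) (L : Line d) : ℝ≥0∞ :=
  if visited A L = {z} then 1
  else if 1 < (visited A L).card ∧ (IsFirst A L z ∨ IsLast A L z) then 1 / 2
  else 0

/-- The mass `b_A(z)` which the ballistic measure on `A` gives to `z`. -/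
def ballisticMeasure {d : ℕ} (A : Finset (Lattice d)) (z : Lattice d) : ℝ≥0∞ :=
  ∫⁻ L, lineWeight A z L ∂(isotropicLine (boxes A))

/-- Ballistic aggregation in `ℤ^d`: incremental aggregation for the family of ballistic measures. -/
def IsBallisticAggregation {d : ℕ} {Ω : Type*} [MeasurableSpace Ω] (P : Measure Ω)
    (F : ℕ → Ω → Finset (Lattice d)) : Prop :=
  IsIncrementalAggregation ballisticMeasure P F

end BallisticAggregation

end

namespace BallisticAggregation

/-! ### Clusters and their outer boundaries -/

/-! The proof combines an atom bound for the ballistic measures with an exponential moment bound for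
the growth.

Atoms. If a cluster $A$ has a point at distance at least $r>0$ from the origin, then every atom of
$b_{\partial A}$ is at most $C/r$ (`exists_ballisticMeasure_le`). Such an atom is at most the
measure of the lines through one box, which is bounded, divided by the measure of the lines through
$\square\partial A$, which is at least of order $r$. For the latter, fix a direction $u$ and project
along it. A cluster is grown by nearest neighbour steps, so its projection has no large gaps, and
each line of direction $u$ through it passes close to $\partial A$; hence the lines through
$\square\partial A$ have measure at least of order $\|\mathrm{proj}_{u^\perp}x\|$
(`Cluster.volume_slab_ge`). Averaging over $u$ turns this into order $\|x\|$
(`Cluster.lineMeasure_hit_boxes_ge`).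

Growth. Let $W_n$ be the expected sum of $e^{\|x\|-r}$ over the points $x\in F_n$ with $\|x\|>r$. A
new point beyond radius $r+1$ has a neighbour in $F_n$ beyond radius $r$, and is chosen with
conditional probability at most $C/r$. Hence $W_{n+1}\le(1+K/r)W_n+e$ with $K=3^d e C$
(`expectedWeight_succ_le`), and $W_n\le e\,n\,e^{nK/r}$. A point beyond $2r$ has weight at least
$e^r$, so $\mathbb P(\operatorname{rad}(F_n)>2r)\le e\,n\,e^{nK/r-r}$. The two exponents balance at
$r\asymp\sqrt n$, where the bound is summable, and Borel–Cantelli concludes. -/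

/-- The clusters that can be grown from the origin by successively adding outer boundary points. -/
inductive Cluster {d : ℕ} : Finset (Lattice d) → Prop
  | singleton_zero : Cluster {0}
  | insert_outerBoundary {A : Finset (Lattice d)} {z : Lattice d} :
      Cluster A → z ∈ outerBoundary A → Cluster (A ∪ {z})

theorem mem_outerBoundary {d : ℕ} {A : Finset (Lattice d)} {y : Lattice d} :
    y ∈ outerBoundary A ↔ y ∉ A ∧ ∃ x ∈ A, ‖emb x - emb y‖ = 1 := by
  rw [outerBoundary, Set.Finite.mem_toFinset]
  rfl

theorem emb_zero {d : ℕ} : emb (0 : Lattice d) = 0 := by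
  ext i
  simp [emb]

theorem norm_emb_sub_update {d : ℕ} (x : Lattice d) (i : Fin d) (v : ℤ) :
    ‖emb x - emb (Function.update x i v)‖ = |(x i : ℝ) - v| := by
  have h : emb x - emb (Function.update x i v) = EuclideanSpace.single i ((x i : ℝ) - v) := by
    ext j
    by_cases hj : j = i
    · subst hj
      simp [emb]
    · simp [emb, hj]
  rw [h, PiLp.norm_single, Real.norm_eq_abs]

theorem norm_le_card_mul {d : ℕ} (v : Space d) {b : ℝ} (hb : 0 ≤ b) (h : ∀ i, |v i| ≤ b) :
    ‖v‖ ≤ d * b := by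
  rw [EuclideanSpace.norm_eq]
  refine Real.sqrt_le_iff.2 ⟨by positivity, ?_⟩
  have h1 : ∑ i, ‖v i‖ ^ 2 ≤ ∑ _i : Fin d, b ^ 2 :=
    Finset.sum_le_sum fun i _ => pow_le_pow_left₀ (norm_nonneg _) (h i) 2
  rw [Finset.sum_const, Finset.card_univ, Fintype.card_fin, nsmul_eq_mul] at h1
  have h2 : (d : ℝ) ≤ d ^ 2 := by exact_mod_cast Nat.le_self_pow two_ne_zero d
  calc _ ≤ (d : ℝ) * b ^ 2 := h1
    _ ≤ (d : ℝ) ^ 2 * b ^ 2 := by gcongr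
    _ = _ := by ring

/-- Changing the coordinates one at a time, one meets the outer boundary of `A` between a point of
`A` and a point outside `A`. -/
theorem exists_mem_outerBoundary_between {d : ℕ} {A : Finset (Lattice d)} {z w : Lattice d}
    (hz : z ∈ A) (hw : w ∉ A) (hzw : ∀ i, |z i - w i| ≤ 1) :
    ∃ y ∈ outerBoundary A, ∀ i, y i = z i ∨ y i = w i := by
  suffices h : ∀ s : Finset (Fin d), s.piecewise w z ∉ A →
      ∃ y ∈ outerBoundary A, ∀ i, y i = z i ∨ y i = w i from
    h Finset.univ (by rwa [Finset.piecewise_univ])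
  intro s
  induction s using Finset.induction_on with
  | empty => intro h; rw [Finset.piecewise_empty] at h; exact absurd hz h
  | insert i s hi ih =>
    intro h
    by_cases hs : s.piecewise w z ∈ A
    · refine ⟨_, mem_outerBoundary.2 ⟨h, _, hs, ?_⟩, fun j => ?_⟩
      · rw [Finset.piecewise_insert, norm_emb_sub_update, Finset.piecewise_eq_of_notMem _ _ _ hi]
        have hne : z i ≠ w i := by
          intro heq
          rw [Finset.piecewise_insert, ← heq] at h
          refine h ?_
          rwa [← Finset.piecewise_eq_of_notMem s w z hi, Function.update_eq_self]
        have h1 : |z i - w i| = 1 :=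
          le_antisymm (hzw i) (Int.one_le_abs (sub_ne_zero.2 hne))
        exact_mod_cast h1
      · by_cases hj : j ∈ insert i s
        · exact Or.inr (Finset.piecewise_eq_of_mem _ _ _ hj)
        · exact Or.inl (Finset.piecewise_eq_of_notMem _ _ _ hj)
    · exact ih hs

/-- Every line through a point of `A` passes close to the outer boundary of `A`. -/
theorem exists_mem_outerBoundary_near_line {d : ℕ} {A : Finset (Lattice d)} {a : Lattice d}
    (ha : a ∈ A) {u : Space d} (hu : ‖u‖ = 1) :
    ∃ y ∈ outerBoundary A, ∃ t : ℝ, ‖emb y - emb a - t • u‖ ≤ d * (3 / 2) := by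
  classical
  -- Round the points $a+ku$ of the ray to the lattice. Since $|u_i|\le1$, consecutive roundings
  -- differ by at most one in each coordinate, so `exists_mem_outerBoundary_between` applies where
  -- the sequence first leaves the finite set `A`.
  set p : ℕ → Lattice d := fun k i => a i + round (k * u i) with hp
  have hu1 : ∀ i, |u i| ≤ 1 := fun i => by
    have := PiLp.norm_apply_le u i
    rwa [hu] at this
  have hex : ∃ k, p k ∉ A := by
    by_contra! hall
    obtain ⟨i, hi⟩ : ∃ i, u i ≠ 0 := by
      by_contra! h
      have : u = 0 := PiLp.ext h
      rw [this, norm_zero] at hu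
      exact zero_ne_one hu
    obtain ⟨M, hM⟩ := (A.image fun z => |((z i - a i : ℤ) : ℝ)|).exists_le
    obtain ⟨k, hk⟩ := exists_nat_gt ((M + 1) / |u i|)
    rw [div_lt_iff₀ (abs_pos.2 hi)] at hk
    have h1 := hM _ (Finset.mem_image_of_mem _ (hall k))
    have h2 := abs_sub_round ((k : ℝ) * u i)
    simp only [hp, add_sub_cancel_left] at h1
    have h3 : |(k : ℝ) * u i| ≤ |(k : ℝ) * u i - round ((k : ℝ) * u i)| +
        |(round ((k : ℝ) * u i) : ℝ)| := by
      simpa using abs_add_le ((k : ℝ) * u i - round ((k : ℝ) * u i)) (round ((k : ℝ) * u i) : ℝ)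
    rw [abs_mul, Nat.abs_cast] at h3
    linarith
  have h0 : p 0 = a := by
    funext i
    simp [hp]
  obtain ⟨k, hk⟩ : ∃ k, Nat.find hex = k + 1 := by
    refine Nat.exists_eq_succ_of_ne_zero fun h => ?_
    have := Nat.find_spec hex
    rw [h, h0] at this
    exact this ha
  have hk1 : p (k + 1) ∉ A := hk ▸ Nat.find_spec hex
  have hk0 : p k ∈ A := not_not.1 (Nat.find_min hex (by omega))
  have hr : ∀ i, |(k : ℝ) * u i - round ((k : ℝ) * u i)| ≤ 1 / 2 ∧
      |((k + 1 : ℕ) : ℝ) * u i - round (((k + 1 : ℕ) : ℝ) * u i)| ≤ 1 / 2 :=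
    fun i => ⟨abs_sub_round _, abs_sub_round _⟩
  obtain ⟨y, hy, hyp⟩ := exists_mem_outerBoundary_between hk0 hk1 (by
    intro i
    simp only [hp, add_sub_add_left_eq_sub, round_eq]
    have h1 := abs_le.1 (hu1 i)
    have h2 : (k : ℝ) * u i + 1 / 2 - 1 ≤ ((k + 1 : ℕ) : ℝ) * u i + 1 / 2 := by
      push_cast; linarith
    have h3 : ((k + 1 : ℕ) : ℝ) * u i + 1 / 2 ≤ (k : ℝ) * u i + 1 / 2 + 1 := by
      push_cast; linarith
    have h4 := Int.floor_le_floor h2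
    have h5 := Int.floor_le_floor h3
    rw [Int.floor_sub_one] at h4
    rw [Int.floor_add_one] at h5
    rw [abs_le]
    omega)
  -- Each coordinate of `y` is that of `p k` or of `p (k + 1)`. Rounding costs $1/2$, and the second
  -- case costs a further $|u_i|\le1$; hence $3/2$.
  refine ⟨y, hy, k, norm_le_card_mul _ (by norm_num) fun i => ?_⟩
  have hc : (emb y - emb a - (k : ℝ) • u) i = (y i : ℝ) - a i - k * u i := by
    simp [emb]
  rw [hc]
  have h1 := abs_le.1 (hu1 i)
  have h2 := abs_le.1 (hr i).1
  have h3 := abs_le.1 (hr i).2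
  rw [abs_le]
  rcases hyp i with h | h
  · rw [h]
    simp only [hp]
    push_cast
    constructor <;> linarith
  · rw [h]
    simp only [hp]
    push_cast at h3 ⊢
    constructor <;> linarith

/-- A cluster has no gaps in any direction. -/
theorem Cluster.exists_inner_near {d : ℕ} {A : Finset (Lattice d)} (hA : Cluster A)
    {e : Space d} (he : ‖e‖ ≤ 1) {x : Lattice d} (hx : x ∈ A) {s : ℝ} (hs0 : 0 ≤ s)
    (hs : s ≤ inner ℝ e (emb x)) : ∃ a ∈ A, |inner ℝ e (emb a) - s| ≤ 1 := by
  induction hA generalizing x with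
  | singleton_zero =>
    rw [Finset.mem_singleton] at hx
    subst hx
    refine ⟨0, Finset.mem_singleton_self 0, ?_⟩
    rw [emb_zero, inner_zero_right] at hs ⊢
    rw [le_antisymm hs hs0]
    simp
  | @insert_outerBoundary A z _ hz ih =>
    have key : ∀ w ∈ A, s ≤ inner ℝ e (emb w) →
        ∃ a ∈ A ∪ {z}, |inner ℝ e (emb a) - s| ≤ 1 := fun w hw h => by
      obtain ⟨a, ha, h'⟩ := ih hw h
      exact ⟨a, Finset.mem_union_left _ ha, h'⟩
    rcases Finset.mem_union.1 hx with h | h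
    · exact key x h hs
    · rw [Finset.mem_singleton] at h
      subst h
      obtain ⟨-, w, hw, hwx⟩ := mem_outerBoundary.1 hz
      by_cases hsw : s ≤ inner ℝ e (emb w)
      · exact key w hw hsw
      -- Here `s` lies between the heights of the neighbours `w` and `x`, which differ by at most
      -- one.
      · refine ⟨w, Finset.mem_union_left _ hw, ?_⟩
        have h1 := abs_real_inner_le_norm e (emb w - emb x)
        rw [hwx, mul_one, inner_sub_right] at h1
        have h2 := abs_le.1 (h1.trans he)
        rw [abs_le]
        constructor <;> linarith

/-! ### The measure of the lines through the boxes of a cluster -/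

theorem isCompact_box {d : ℕ} (z : Lattice d) : IsCompact (box z) := by
  refine Metric.isCompact_of_isClosed_isBounded ?_ ?_
  · simp only [box, ofPred_forall]
    exact isClosed_iInter fun i => isClosed_le (by fun_prop) continuous_const
  · refine (Metric.isBounded_closedBall (x := emb z) (r := d * (1 / 2))).subset fun x hx => ?_
    rw [mem_closedBall_iff_norm]
    exact norm_le_card_mul _ (by norm_num) hx

theorem convex_box {d : ℕ} (z : Lattice d) : Convex ℝ (box z) := by
  intro x hx y hy a b ha hb hab i
  have h1 := abs_le.1 (hx i)
  have h2 := abs_le.1 (hy i)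
  have hb' : b = 1 - a := by linarith
  subst hb'
  simp only [PiLp.add_apply, PiLp.smul_apply, smul_eq_mul]
  rw [abs_le]
  constructor <;> nlinarith

theorem measurableSet_hit_box {d : ℕ} (z : Lattice d) : MeasurableSet (hit (box z)) :=
  MeasurableSpace.measurableSet_generateFrom ⟨_, isCompact_box z, convex_box z, rfl⟩

theorem mem_hit_boxes {d : ℕ} {A : Finset (Lattice d)} {L : Line d} :
    L ∈ hit (boxes A) ↔ ∃ z ∈ A, L ∈ hit (box z) := by
  simp only [hit, boxes, mem_ofPred_eq, inter_iUnion, nonempty_iUnion, exists_prop]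

theorem measurableSet_hit_boxes {d : ℕ} (A : Finset (Lattice d)) :
    MeasurableSet (hit (boxes A)) := by
  have h : hit (boxes A) = ⋃ z ∈ A, hit (box z) := by
    ext L
    simp only [mem_hit_boxes, mem_iUnion, exists_prop]
  rw [h]
  exact A.measurableSet_biUnion fun z _ => measurableSet_hit_box z

theorem inner_self_sphere {d : ℕ} (u : UnitSphere d) :
    inner ℝ (u : Space d) (u : Space d) = 1 := by
  rw [real_inner_self_eq_norm_sq, norm_eq_of_mem_sphere u, one_pow]

/-- For each direction `u`, a slab point whose line meets the box lies within $d+1$ of the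
projection of the centre to $u^\perp$: at most $2\cdot d/2$ across `u` and at most $1$ along `u`. -/
theorem lineMeasure_hit_box_le {d : ℕ} [NeZero d] (z : Lattice d) :
    lineMeasure d (hit (box z)) ≤
      (volume : Measure (Space d)) (Metric.closedBall 0 (d + 1)) := by
  rw [lineMeasure_apply_slab (measurableSet_hit_box z)]
  calc _ ≤ ∫⁻ _u : UnitSphere d, (volume : Measure (Space d)) (Metric.closedBall 0 (d + 1))
        ∂(sphereUniform d) := ?_
    _ = _ := by rw [lintegral_const, measure_univ, mul_one]
  refine lintegral_mono fun u => ?_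
  rw [← Measure.addHaar_closedBall_center volume
    (emb z - inner ℝ (u : Space d) (emb z) • (u : Space d))]
  refine measure_mono fun y hy => ?_
  obtain ⟨⟨h0, h1⟩, q, hq, hqz⟩ := hy
  obtain ⟨t, rfl⟩ := (mem_lineThrough u y q).1 hq
  have hn : ‖y + t • (u : Space d) - emb z‖ ≤ d * (1 / 2) :=
    norm_le_card_mul _ (by norm_num) hqz
  set v := y + t • (u : Space d) - emb z with hv
  have hy : y - (emb z - inner ℝ (u : Space d) (emb z) • (u : Space d)) =
      (v - inner ℝ (u : Space d) v • (u : Space d)) +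
        inner ℝ (u : Space d) y • (u : Space d) := by
    rw [hv, inner_sub_right, inner_add_right, inner_smul_right, inner_self_sphere]
    module
  have hu := norm_eq_of_mem_sphere u
  have h2 : ‖v - inner ℝ (u : Space d) v • (u : Space d)‖ ≤ ‖v‖ + ‖v‖ := by
    refine (norm_sub_le _ _).trans (add_le_add_right ?_ _)
    rw [norm_smul, hu, mul_one]
    simpa [hu] using norm_inner_le_norm (𝕜 := ℝ) (u : Space d) v
  have h3 : ‖inner ℝ (u : Space d) y • (u : Space d)‖ ≤ 1 := by
    rw [norm_smul, hu, mul_one, Real.norm_eq_abs, abs_of_nonneg h0]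
    exact h1
  rw [mem_closedBall_iff_norm, hy]
  refine (norm_add_le _ _).trans ?_
  linarith

/-- Let `e` be the direction of the projection of `x` to $u^\perp$. Near each height $k(3d+4)$ along
`e` the cluster has a point, and the line through it in direction `u` passes near some
$z_k\in\partial A$. Moving along `u` does not change the height, so the projected $z_k$ are well
separated, and disjoint balls around them fill the required volume. -/
theorem Cluster.volume_slab_ge {d : ℕ} {A : Finset (Lattice d)} (hA : Cluster A)
    {x : Lattice d} (hx : x ∈ A) (u : UnitSphere d) :
    ENNReal.ofReal (‖emb x - inner ℝ (u : Space d) (emb x) • (u : Space d)‖ / (3 * d + 4)) *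
        (volume : Measure (Space d)) (Metric.ball 0 (1 / 2)) ≤
      (volume : Measure (Space d)) {y | inner ℝ (u : Space d) y ∈ Icc (0 : ℝ) 1 ∧
        lineThrough u y ∈ hit (boxes (outerBoundary A))} := by
  have hu := norm_eq_of_mem_sphere u
  have huu := inner_self_sphere u
  set w := emb x - inner ℝ (u : Space d) (emb x) • (u : Space d) with hw
  rcases eq_or_ne w 0 with h0 | h0
  · rw [h0, norm_zero, zero_div, ENNReal.ofReal_zero, zero_mul]
    exact zero_le
  have hwpos : 0 < ‖w‖ := norm_pos_iff.2 h0
  set e := ‖w‖⁻¹ • w with he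
  have hwu : inner ℝ w (u : Space d) = 0 := by
    rw [hw, inner_sub_left, inner_smul_left, huu, real_inner_comm]
    simp
  have heu : inner ℝ e (u : Space d) = 0 := by
    rw [he, inner_smul_left, hwu, mul_zero]
  have he1 : ‖e‖ = 1 := by
    rw [he, norm_smul, norm_inv, norm_norm, inv_mul_cancel₀ hwpos.ne']
  have hex : inner ℝ e (emb x) = ‖w‖ := by
    have h : emb x = w + inner ℝ (u : Space d) (emb x) • (u : Space d) := by
      rw [hw]; abel
    rw [h, inner_add_right, inner_smul_right, heu, mul_zero, add_zero, he, inner_smul_left,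
      real_inner_self_eq_norm_sq]
    simp only [RCLike.conj_to_real]
    field_simp
  -- The heights of the $z_k$ are off by at most $1+3d/2$, so the spacing $3d+4$ keeps distinct ones
  -- at least $2$ apart.
  have hD : (0 : ℝ) < 3 * d + 4 := by positivity
  set m := ⌊‖w‖ / (3 * d + 4)⌋₊
  have hz : ∀ k : ℕ, ∃ z, k < m + 1 →
      z ∈ outerBoundary A ∧ |inner ℝ e (emb z) - k * (3 * d + 4)| ≤ 1 + d * (3 / 2) := by
    intro k
    by_cases hk : k < m + 1
    · have hkm : (k : ℝ) ≤ ‖w‖ / (3 * d + 4) :=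
        (Nat.le_floor_iff (by positivity)).1 (Nat.lt_succ_iff.1 hk)
      rw [le_div_iff₀ hD] at hkm
      obtain ⟨a, ha, has⟩ := hA.exists_inner_near he1.le hx
        (s := k * (3 * d + 4)) (by positivity) (hex ▸ hkm)
      obtain ⟨z, hz, t, ht⟩ := exists_mem_outerBoundary_near_line ha hu
      refine ⟨z, fun _ => ⟨hz, ?_⟩⟩
      have h1 := abs_real_inner_le_norm e (emb z - emb a - t • (u : Space d))
      rw [he1, one_mul, inner_sub_right, inner_sub_right, inner_smul_right, heu, mul_zero,
        sub_zero] at h1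
      have h2 := abs_le.1 (h1.trans ht)
      have h3 := abs_le.1 has
      rw [abs_le]
      constructor <;> linarith
    · exact ⟨0, fun h => absurd h hk⟩
  choose z hz using hz
  -- The shift by $u/2$ puts the centres in the middle of the slab, so that balls of radius $1/2$
  -- stay inside it.
  set c : ℕ → Space d := fun k => emb (z k) - inner ℝ (u : Space d) (emb (z k)) • (u : Space d) +
    (1 / 2 : ℝ) • (u : Space d) with hc
  have hec : ∀ k, inner ℝ e (c k) = inner ℝ e (emb (z k)) := fun k => by
    simp only [hc, inner_add_right, inner_sub_right, inner_smul_right, heu, mul_zero, sub_zero,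
      add_zero]
  have hdisj : (↑(Finset.range (m + 1)) : Set ℕ).PairwiseDisjoint
      fun k => Metric.ball (c k) (1 / 2) := by
    have hlt : ∀ k l : ℕ, k < l → l < m + 1 →
        Disjoint (Metric.ball (c k) (1 / 2)) (Metric.ball (c l) (1 / 2)) := by
      intro k l hkl hl
      refine Metric.ball_disjoint_ball ?_
      have h1 := abs_real_inner_le_norm e (c l - c k)
      rw [he1, one_mul, inner_sub_right, hec, hec] at h1
      have h2 := abs_le.1 (hz k (hkl.trans hl)).2
      have h3 := abs_le.1 (hz l hl).2
      have h4 : (k : ℝ) + 1 ≤ l := by exact_mod_cast hkl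
      have h5 := (le_abs_self _).trans h1
      rw [dist_comm, dist_eq_norm]
      nlinarith
    intro k hk l hl hkl
    simp only [Finset.coe_range, mem_Iio] at hk hl
    rcases lt_or_gt_of_ne hkl with h | h
    · exact hlt k l h hl
    · exact (hlt l k h hk).symm
  calc _ ≤ ((m + 1 : ℕ) : ℝ≥0∞) * (volume : Measure (Space d)) (Metric.ball 0 (1 / 2)) := by
        gcongr
        rw [← ENNReal.ofReal_natCast]
        refine ENNReal.ofReal_le_ofReal ?_
        push_cast
        exact (Nat.lt_floor_add_one _).le
    _ = volume (⋃ k ∈ Finset.range (m + 1), Metric.ball (c k) (1 / 2)) := by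
        rw [measure_biUnion_finset hdisj fun _ _ => Metric.isOpen_ball.measurableSet]
        simp_rw [Measure.addHaar_ball_center volume (c _)]
        rw [Finset.sum_const, Finset.card_range, nsmul_eq_mul]
    _ ≤ _ := by
        refine measure_mono (iUnion₂_subset fun k hk y hy => ?_)
        rw [Finset.mem_range] at hk
        rw [mem_ball_iff_norm] at hy
        have huc : inner ℝ (u : Space d) (c k) = 1 / 2 := by
          simp only [hc, inner_add_right, inner_sub_right, inner_smul_right, huu]
          ring
        refine ⟨?_, mem_hit_boxes.2 ⟨z k, (hz k hk).1, ?_⟩⟩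
        · have h1 := abs_real_inner_le_norm (u : Space d) (y - c k)
          rw [hu, one_mul, inner_sub_right, huc] at h1
          have h2 := abs_le.1 (h1.trans hy.le)
          constructor <;> linarith
        -- The translation along `u` that takes `c k` to `emb (z k)` takes `y` to a point within
        -- $1/2$ of `emb (z k)`, hence in its box.
        · refine ⟨y + (inner ℝ (u : Space d) (emb (z k)) - 1 / 2) • (u : Space d),
            (mem_lineThrough _ _ _).2 ⟨_, rfl⟩, fun i => ?_⟩
          have h1 : y + (inner ℝ (u : Space d) (emb (z k)) - 1 / 2) • (u : Space d) -
              emb (z k) = y - c k := by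
            simp only [hc]
            module
          exact ((PiLp.norm_apply_le (y + (inner ℝ (u : Space d) (emb (z k)) - 1 / 2) •
            (u : Space d) - emb (z k)) i).trans_eq (by rw [h1])).trans hy.le

/-- The reflection in the hyperplane orthogonal to $v-w$ takes `v` to `w` and preserves the uniform
distribution. -/
theorem lintegral_inner_sq_eq {d : ℕ} {v w : Space d} (h : ‖v‖ = ‖w‖) :
    ∫⁻ u : UnitSphere d, ENNReal.ofReal (inner ℝ v (u : Space d) ^ 2) ∂(sphereUniform d) =
      ∫⁻ u : UnitSphere d, ENNReal.ofReal (inner ℝ w (u : Space d) ^ 2) ∂(sphereUniform d) := by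
  have hR := Submodule.reflection_sub h
  set R := (Submodule.span ℝ {v - w})ᗮ.reflection
  rw [← (measurePreserving_rotate R).lintegral_comp
    (f := fun u : UnitSphere d => ENNReal.ofReal (inner ℝ w (u : Space d) ^ 2)) (by fun_prop)]
  refine lintegral_congr fun u => ?_
  rw [← hR]
  congr 2
  exact (R.inner_map_map v u).symm

/-- By symmetry the integral equals that of each squared coordinate. These add up to one, so it is
$1/d$, which is at most $1/2$ because $d\ge2$. -/
theorem lintegral_inner_sq_le_half {d : ℕ} (hd : 2 ≤ d) {v : Space d} (hv : ‖v‖ = 1) :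
    ∫⁻ u : UnitSphere d, ENNReal.ofReal (inner ℝ v (u : Space d) ^ 2) ∂(sphereUniform d) ≤
      2⁻¹ := by
  have : NeZero d := ⟨by omega⟩
  set I := ∫⁻ u : UnitSphere d, ENNReal.ofReal (inner ℝ v (u : Space d) ^ 2) ∂(sphereUniform d)
    with hI
  have hsum : (d : ℝ≥0∞) * I = 1 := by
    have hi : ∀ i : Fin d, ∫⁻ u : UnitSphere d, ENNReal.ofReal ((u : Space d) i ^ 2)
        ∂(sphereUniform d) = I := fun i => by
      rw [hI, lintegral_inner_sq_eq (w := EuclideanSpace.single i (1 : ℝ)) (by simp [hv])]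
      simp [EuclideanSpace.inner_single_left]
    calc (d : ℝ≥0∞) * I = ∑ i : Fin d, ∫⁻ u : UnitSphere d,
          ENNReal.ofReal ((u : Space d) i ^ 2) ∂(sphereUniform d) := by
          simp_rw [hi]
          simp
      _ = ∫⁻ _u : UnitSphere d, 1 ∂(sphereUniform d) := by
          rw [← lintegral_finsetSum _ fun i _ => by fun_prop]
          refine lintegral_congr fun u => ?_
          rw [← ENNReal.ofReal_sum_of_nonneg fun i _ => sq_nonneg _]
          have h := EuclideanSpace.norm_sq_eq (u : Space d)
          rw [norm_eq_of_mem_sphere u] at h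
          simp only [Real.norm_eq_abs, sq_abs] at h
          rw [← h]
          simp
      _ = 1 := by simp
  rw [← ENNReal.mul_le_mul_iff_right (a := 2) (by simp) (by simp),
    ENNReal.mul_inv_cancel (by simp) (by simp), ← hsum]
  gcongr
  exact_mod_cast hd

/-- With $v=x/\|x\|$, the projection of `x` to $u^\perp$ has norm $\|x\|\sqrt{1-\langle
v,u\rangle^2}\ge\|x\|(1-\langle v,u\rangle^2)$, and the last factor has mean at least $1/2$. -/
theorem Cluster.lineMeasure_hit_boxes_ge {d : ℕ} (hd : 2 ≤ d) {A : Finset (Lattice d)}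
    (hA : Cluster A) {x : Lattice d} (hx : x ∈ A) :
    ENNReal.ofReal (‖emb x‖ / (3 * d + 4)) * 2⁻¹ *
        (volume : Measure (Space d)) (Metric.ball 0 (1 / 2)) ≤
      lineMeasure d (hit (boxes (outerBoundary A))) := by
  have : NeZero d := ⟨by omega⟩
  rcases eq_or_ne (emb x) 0 with h0 | h0
  · rw [h0, norm_zero, zero_div, ENNReal.ofReal_zero, zero_mul, zero_mul]
    exact zero_le
  have hpos : 0 < ‖emb x‖ := norm_pos_iff.2 h0
  set v := ‖emb x‖⁻¹ • emb x with hv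
  have hv1 : ‖v‖ = 1 := by
    rw [hv, norm_smul, norm_inv, norm_norm, inv_mul_cancel₀ hpos.ne']
  have hxv : emb x = ‖emb x‖ • v := by
    rw [hv, smul_smul, mul_inv_cancel₀ hpos.ne', one_smul]
  have hhalf : (2⁻¹ : ℝ≥0∞) ≤ ∫⁻ u : UnitSphere d,
      ENNReal.ofReal (1 - inner ℝ v (u : Space d) ^ 2) ∂(sphereUniform d) := by
    have h1 : ∫⁻ u : UnitSphere d, ENNReal.ofReal (1 - inner ℝ v (u : Space d) ^ 2)
        ∂(sphereUniform d) + ∫⁻ u : UnitSphere d,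
          ENNReal.ofReal (inner ℝ v (u : Space d) ^ 2) ∂(sphereUniform d) = 1 := by
      rw [← lintegral_add_left (by fun_prop)]
      calc _ = ∫⁻ _u : UnitSphere d, 1 ∂(sphereUniform d) := by
            refine lintegral_congr fun u => ?_
            have h := abs_real_inner_le_norm v (u : Space d)
            rw [hv1, norm_eq_of_mem_sphere u, one_mul] at h
            rw [← ENNReal.ofReal_add (sub_nonneg.2 ((sq_le_one_iff_abs_le_one _).2 h))
              (sq_nonneg _)]
            simp
        _ = 1 := by simp
    have h2 := lintegral_inner_sq_le_half hd hv1
    by_contra! hlt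
    have h3 := ENNReal.add_lt_add_of_lt_of_le
      (ne_top_of_le_ne_top (by simp) h2) hlt h2
    rw [h1, ENNReal.inv_two_add_inv_two] at h3
    exact lt_irrefl _ h3
  rw [lineMeasure_apply_slab (measurableSet_hit_boxes _)]
  calc _ ≤ ENNReal.ofReal (‖emb x‖ / (3 * d + 4)) * (∫⁻ u : UnitSphere d,
          ENNReal.ofReal (1 - inner ℝ v (u : Space d) ^ 2) ∂(sphereUniform d)) *
        (volume : Measure (Space d)) (Metric.ball 0 (1 / 2)) := by gcongr
    _ = ∫⁻ u : UnitSphere d, ENNReal.ofReal (‖emb x‖ / (3 * d + 4)) *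
          ENNReal.ofReal (1 - inner ℝ v (u : Space d) ^ 2) *
          (volume : Measure (Space d)) (Metric.ball 0 (1 / 2)) ∂(sphereUniform d) := by
        rw [lintegral_mul_const _ (by fun_prop), lintegral_const_mul _ (by fun_prop)]
    _ ≤ _ := by
        refine lintegral_mono fun u => le_trans ?_ (hA.volume_slab_ge hx u)
        gcongr
        rw [← ENNReal.ofReal_mul (by positivity)]
        refine ENNReal.ofReal_le_ofReal ?_
        have hu := norm_eq_of_mem_sphere u
        set q := inner ℝ v (u : Space d) with hq
        have hqu : inner ℝ (u : Space d) v = q := real_inner_comm _ _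
        have hwn : emb x - inner ℝ (u : Space d) (emb x) • (u : Space d) =
            ‖emb x‖ • (v - q • (u : Space d)) := by
          conv_lhs => rw [hxv]
          rw [inner_smul_right, hqu, smul_sub, mul_smul]
        have hsq : ‖v - q • (u : Space d)‖ ^ 2 = 1 - q ^ 2 := by
          rw [norm_sub_sq_real, inner_smul_right, ← hq, hv1, norm_smul, hu, Real.norm_eq_abs,
            mul_one, sq_abs]
          ring
        have hle : 1 - q ^ 2 ≤ ‖v - q • (u : Space d)‖ := by
          have := norm_nonneg (v - q • (u : Space d))
          nlinarith [sq_nonneg q]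
        rw [hwn, norm_smul, norm_norm, div_mul_eq_mul_div]
        gcongr

/-! ### The ballistic measures -/

/-- All that the argument needs of the weights: they vanish for `z` outside `A` and for lines
missing the box, and never exceed one. The order of the visits plays no role. -/
theorem lineWeight_le_indicator {d : ℕ} (A : Finset (Lattice d)) (z : Lattice d) (L : Line d) :
    lineWeight A z L ≤ (if z ∈ A then 1 else 0) * (hit (box z)).indicator 1 L := by
  classical
  by_cases hz : z ∈ visited A L
  · have h := hz
    rw [visited, Finset.mem_filter] at h
    have h2 : L ∈ hit (box z) := h.2
    rw [if_pos h.1, one_mul, indicator_of_mem h2, Pi.one_apply, lineWeight]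
    split_ifs
    · exact le_rfl
    · simp
    · exact zero_le
  · have h1 : visited A L ≠ {z} := fun h => hz (h ▸ Finset.mem_singleton_self z)
    have h2 : ¬ (1 < (visited A L).card ∧ (IsFirst A L z ∨ IsLast A L z)) := by
      rintro ⟨-, h | h⟩
      · exact hz h.1
      · exact hz h.1
    rw [lineWeight, if_neg h1, if_neg h2]
    exact zero_le

theorem ballisticMeasure_eq_zero {d : ℕ} {A : Finset (Lattice d)} {z : Lattice d} (hz : z ∉ A) :
    ballisticMeasure A z = 0 := by
  rw [ballisticMeasure]
  refine (lintegral_congr fun L => ?_).trans lintegral_zero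
  have h := lineWeight_le_indicator A z L
  rw [if_neg hz, zero_mul] at h
  exact nonpos_iff_eq_zero.1 h

theorem ballisticMeasure_le {d : ℕ} (A : Finset (Lattice d)) (z : Lattice d) :
    ballisticMeasure A z ≤ (lineMeasure d (hit (boxes A)))⁻¹ * lineMeasure d (hit (box z)) := by
  rw [ballisticMeasure, isotropicLine, ProbabilityTheory.cond, lintegral_smul_measure, smul_eq_mul]
  gcongr
  calc _ ≤ ∫⁻ L, (hit (box z)).indicator 1 L ∂(lineMeasure d).restrict (hit (boxes A)) := by
        refine lintegral_mono fun L => (lineWeight_le_indicator A z L).trans ?_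
        split_ifs
        · rw [one_mul]
        · rw [zero_mul]; exact zero_le
    _ ≤ ∫⁻ L, (hit (box z)).indicator 1 L ∂(lineMeasure d) :=
        lintegral_mono' Measure.restrict_le_self le_rfl
    _ = _ := lintegral_indicator_one (measurableSet_hit_box z)

/-- The ballistic measure on the outer boundary of a cluster of radius `r` has no atoms of mass
larger than a constant times `1 / r`. -/
theorem exists_ballisticMeasure_le {d : ℕ} (hd : 2 ≤ d) :
    ∃ C : ℝ, 0 ≤ C ∧ ∀ A : Finset (Lattice d), Cluster A → ∀ x ∈ A, ∀ r : ℝ, 0 < r → r ≤ ‖emb x‖ →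
      ∀ z, ballisticMeasure (outerBoundary A) z ≤ ENNReal.ofReal (C / r) := by
  have : NeZero d := ⟨by omega⟩
  set V := (volume : Measure (Space d)) (Metric.closedBall 0 (d + 1)) with hV
  set v := (volume : Measure (Space d)) (Metric.ball 0 (1 / 2)) with hv
  have hVtop : V ≠ ⊤ := measure_closedBall_lt_top.ne
  have hvtop : v ≠ ⊤ := measure_ball_lt_top.ne
  have hvpos : 0 < v.toReal :=
    ENNReal.toReal_pos (Metric.measure_ball_pos volume _ (by norm_num)).ne' hvtop
  -- The bound `V` for one box, divided by the lower bound $\frac{r}{3d+4}\cdot\frac12\cdot v$ for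
  -- all boxes.
  refine ⟨V.toReal * (2 * (3 * d + 4)) / v.toReal, by positivity, fun A hA x hx r hr hrx z => ?_⟩
  have h1 : ENNReal.ofReal (r / (3 * d + 4) * 2⁻¹ * v.toReal) ≤
      lineMeasure d (hit (boxes (outerBoundary A))) := by
    refine le_trans ?_ (hA.lineMeasure_hit_boxes_ge hd hx)
    rw [ENNReal.ofReal_mul (by positivity), ENNReal.ofReal_mul (by positivity),
      ENNReal.ofReal_toReal hvtop, ENNReal.ofReal_inv_of_pos two_pos, ENNReal.ofReal_ofNat]
    gcongr
  calc _ ≤ _ := ballisticMeasure_le _ _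
    _ ≤ (ENNReal.ofReal (r / (3 * d + 4) * 2⁻¹ * v.toReal))⁻¹ * ENNReal.ofReal V.toReal := by
        rw [ENNReal.ofReal_toReal hVtop]
        gcongr
        exact lineMeasure_hit_box_le z
    _ = _ := by
        rw [← ENNReal.ofReal_inv_of_pos (by positivity), ← ENNReal.ofReal_mul (by positivity)]
        congr 1
        field_simp

/-! ### Ballistic aggregation grows clusters -/

/-- The product form of the conditional law also holds when the conditioning event is null. -/
theorem measure_inter_eq_of_isBallisticAggregation {d : ℕ} {Ω : Type*} [MeasurableSpace Ω]
    {P : Measure Ω} [IsProbabilityMeasure P] {F : ℕ → Ω → Finset (Lattice d)} {n : ℕ}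
    (hF : Measurable[_, ⊤] (F n)) {y : Ω → Lattice d}
    (hy : ∀ A : Finset (Lattice d), P {ω | F n ω = A} ≠ 0 →
      ∀ z, ProbabilityTheory.cond P {ω | F n ω = A} {ω | y ω = z} =
        ballisticMeasure (outerBoundary A) z)
    (A : Finset (Lattice d)) (z : Lattice d) :
    P ({ω | F n ω = A} ∩ {ω | y ω = z}) =
      P {ω | F n ω = A} * ballisticMeasure (outerBoundary A) z := by
  have hm : MeasurableSet {ω | F n ω = A} := hF (t := {A}) trivial
  by_cases h0 : P {ω | F n ω = A} = 0
  · rw [h0, zero_mul]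
    exact measure_mono_null inter_subset_left h0
  · rw [← hy A h0 z, ProbabilityTheory.cond_apply hm, ← mul_assoc,
      ENNReal.mul_inv_cancel h0 (measure_ne_top _ _), one_mul]

theorem cluster_of_measure_ne_zero {d : ℕ} {Ω : Type*} [MeasurableSpace Ω]
    {P : Measure Ω} [IsProbabilityMeasure P] {F : ℕ → Ω → Finset (Lattice d)}
    (hF : IsBallisticAggregation P F) {n : ℕ} (hn : 1 ≤ n) {A : Finset (Lattice d)}
    (hA : P {ω | F n ω = A} ≠ 0) : Cluster A := by
  induction n, hn using Nat.le_induction generalizing A with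
  | base =>
    obtain ⟨ω, hω⟩ := nonempty_of_measure_ne_zero hA
    have h1 : F 1 ω = A := hω
    rw [← h1, hF.start]
    exact Cluster.singleton_zero
  | succ n hn ih =>
    obtain ⟨y, -, hFy, hy⟩ := hF.step n hn
    by_contra hc
    -- There are only countably many pairs of values of `F n` and `y`, so a value of `F (n + 1)` of
    -- positive probability arises from a pair of positive probability.
    refine hA (measure_mono_null (t := ⋃ p : Finset (Lattice d) × Lattice d,
      {ω | F (n + 1) ω = A} ∩ ({ω | F n ω = p.1} ∩ {ω | y ω = p.2}))
      (fun ω hω => mem_iUnion.2 ⟨(F n ω, y ω), hω, rfl, rfl⟩) ?_)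
    refine measure_iUnion_null fun p => ?_
    by_contra hp
    have h1 : P ({ω | F n ω = p.1} ∩ {ω | y ω = p.2}) ≠ 0 :=
      fun h => hp (measure_mono_null inter_subset_right h)
    rw [measure_inter_eq_of_isBallisticAggregation (hF.measurable n hn) hy] at h1
    obtain ⟨ω, hω, hω1, hω2⟩ := nonempty_of_measure_ne_zero hp
    have hAe : A = p.1 ∪ {p.2} := by
      rw [← show F (n + 1) ω = A from hω, hFy, show F n ω = p.1 from hω1,
        show y ω = p.2 from hω2]
    refine hc (hAe ▸ Cluster.insert_outerBoundary (ih (left_ne_zero_of_mul h1)) ?_)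
    by_contra hz
    exact right_ne_zero_of_mul h1 (ballisticMeasure_eq_zero hz)

/-! ### Expected exponential weight of the growing cluster -/

/-- The exponential weight of a lattice point outside the ball of radius `r`. -/
noncomputable def expWeight {d : ℕ} (r : ℝ) (x : Lattice d) : ℝ≥0∞ :=
  if r < ‖emb x‖ then ENNReal.ofReal (Real.exp (‖emb x‖ - r)) else 0

/-- The expected total exponential weight of a random finite set. -/
noncomputable def expectedWeight {d : ℕ} {Ω : Type*} [MeasurableSpace Ω] (P : Measure Ω)
    (r : ℝ) (F : Ω → Finset (Lattice d)) : ℝ≥0∞ :=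
  ∑' x, expWeight r x * P {ω | x ∈ F ω}

theorem neighbor_mem_Icc {d : ℕ} {x w : Lattice d} (h : ‖emb w - emb x‖ = 1) :
    w ∈ Finset.Icc (x - 1) (x + 1) := by
  have key : ∀ i, |w i - x i| ≤ 1 := by
    intro i
    have h1 := PiLp.norm_apply_le (emb w - emb x) i
    rw [h, Real.norm_eq_abs] at h1
    simp only [emb, PiLp.sub_apply] at h1
    exact_mod_cast h1
  simp only [Finset.mem_Icc, Pi.le_def, Pi.sub_apply, Pi.add_apply, Pi.one_apply]
  have h1 := fun i => abs_le.1 (key i)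
  refine ⟨fun i => ?_, fun i => ?_⟩ <;>
    · have := h1 i
      omega

theorem card_Icc_sub_one_add_one {d : ℕ} (x : Lattice d) :
    (Finset.Icc (x - 1) (x + 1)).card = 3 ^ d := by
  rw [Pi.card_Icc]
  have h : ∀ i, (Finset.Icc ((x - 1) i) ((x + 1) i)).card = 3 := fun i => by
    rw [Int.card_Icc]
    simp only [Pi.sub_apply, Pi.add_apply, Pi.one_apply]
    omega
  simp only [h, Finset.prod_const, Finset.card_univ, Fintype.card_fin]

section Growth

variable {d : ℕ} {Ω : Type*} [MeasurableSpace Ω] {P : Measure Ω} [IsProbabilityMeasure P]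
  {F : ℕ → Ω → Finset (Lattice d)} {C r : ℝ} {n : ℕ} {y : Ω → Lattice d}

/-- Split according to the value of `F n`: each value of positive probability is a cluster, and it
contains `w`, so the same atom bound applies to all of them. -/
theorem measure_mem_inter_le (hF : IsBallisticAggregation P F)
    (hC : ∀ A : Finset (Lattice d), Cluster A → ∀ x ∈ A, ∀ r : ℝ, 0 < r → r ≤ ‖emb x‖ →
      ∀ z, ballisticMeasure (outerBoundary A) z ≤ ENNReal.ofReal (C / r))
    (hr : 0 < r) (hn : 1 ≤ n)
    (hy : ∀ A : Finset (Lattice d), P {ω | F n ω = A} ≠ 0 →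
      ∀ z, ProbabilityTheory.cond P {ω | F n ω = A} {ω | y ω = z} =
        ballisticMeasure (outerBoundary A) z)
    {w : Lattice d} (hw : r ≤ ‖emb w‖) (z : Lattice d) :
    P ({ω | w ∈ F n ω} ∩ {ω | y ω = z}) ≤ ENNReal.ofReal (C / r) * P {ω | w ∈ F n ω} := by
  have hunion : {ω | w ∈ F n ω} = ⋃ A : {A : Finset (Lattice d) // w ∈ A}, {ω | F n ω = A} := by
    ext ω
    simp
  have hm : ∀ A : Finset (Lattice d), MeasurableSet {ω | F n ω = A} := fun A =>
    hF.measurable n hn (t := {A}) trivial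
  have hP : P {ω | w ∈ F n ω} = ∑' A : {A : Finset (Lattice d) // w ∈ A}, P {ω | F n ω = A} := by
    rw [hunion]
    refine measure_iUnion (fun A B hAB => ?_) fun A => hm A
    refine Set.disjoint_left.2 fun ω hA hB => hAB (Subtype.ext ?_)
    exact Eq.trans (Eq.symm hA) hB
  rw [hP, ← ENNReal.tsum_mul_left, hunion, iUnion_inter]
  refine (measure_iUnion_le _).trans (ENNReal.tsum_le_tsum fun A => ?_)
  rw [measure_inter_eq_of_isBallisticAggregation (hF.measurable n hn) hy, mul_comm]
  by_cases h0 : P {ω | F n ω = A} = 0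
  · simp [h0]
  · gcongr
    exact hC A (cluster_of_measure_ne_zero hF hn h0) w A.2 r hr hw z

/-- Almost surely the new point lies in the outer boundary, so it has a neighbour in the old
cluster; a union bound over the neighbours follows. -/
theorem measure_eq_le_sum_neighbors (hF : IsBallisticAggregation P F) (hn : 1 ≤ n)
    (hy : ∀ A : Finset (Lattice d), P {ω | F n ω = A} ≠ 0 →
      ∀ z, ProbabilityTheory.cond P {ω | F n ω = A} {ω | y ω = z} =
        ballisticMeasure (outerBoundary A) z) (x : Lattice d) :
    P {ω | y ω = x} ≤ ∑ w ∈ (Finset.Icc (x - 1) (x + 1)).filter (fun w => ‖emb w - emb x‖ = 1),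
      P ({ω | w ∈ F n ω} ∩ {ω | y ω = x}) := by
  refine le_trans ?_ (measure_biUnion_finset_le _ _)
  have hnull : P (⋃ A : {A : Finset (Lattice d) // x ∉ outerBoundary A},
      {ω | F n ω = A} ∩ {ω | y ω = x}) = 0 := by
    refine measure_iUnion_null fun A => ?_
    rw [measure_inter_eq_of_isBallisticAggregation (hF.measurable n hn) hy,
      ballisticMeasure_eq_zero A.2, mul_zero]
  refine le_trans (measure_mono fun ω hω => ?_)
    ((measure_union_le _ _).trans_eq ((congrArg _ hnull).trans (add_zero _)))
  by_cases hx : x ∈ outerBoundary (F n ω)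
  · obtain ⟨-, w, hw, hwx⟩ := mem_outerBoundary.1 hx
    exact Or.inl (mem_iUnion₂.2
      ⟨w, Finset.mem_filter.2 ⟨neighbor_mem_Icc hwx, hwx⟩, hw, hω⟩)
  · exact Or.inr (mem_iUnion.2 ⟨⟨F n ω, hx⟩, rfl, hω⟩)

/-- Up to radius $r+1$ the weight is at most $e$. Farther out all neighbours lie beyond `r`, where
passing to a neighbour changes the weight by a factor of at most $e$, so the new point is charged to
a neighbour already present. -/
theorem expWeight_mul_measure_le (hF : IsBallisticAggregation P F)
    (hC : ∀ A : Finset (Lattice d), Cluster A → ∀ x ∈ A, ∀ r : ℝ, 0 < r → r ≤ ‖emb x‖ →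
      ∀ z, ballisticMeasure (outerBoundary A) z ≤ ENNReal.ofReal (C / r))
    (hr : 0 < r) (hn : 1 ≤ n)
    (hy : ∀ A : Finset (Lattice d), P {ω | F n ω = A} ≠ 0 →
      ∀ z, ProbabilityTheory.cond P {ω | F n ω = A} {ω | y ω = z} =
        ballisticMeasure (outerBoundary A) z) (x : Lattice d) :
    expWeight r x * P {ω | y ω = x} ≤ ENNReal.ofReal (Real.exp 1) * P {ω | y ω = x} +
      ∑ w ∈ Finset.Icc (x - 1) (x + 1), ENNReal.ofReal (Real.exp 1) * ENNReal.ofReal (C / r) *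
        (expWeight r w * P {ω | w ∈ F n ω}) := by
  by_cases hx : ‖emb x‖ ≤ r + 1
  · refine le_add_right ?_
    gcongr
    rw [expWeight]
    split_ifs
    · exact ENNReal.ofReal_le_ofReal (Real.exp_le_exp.2 (by linarith))
    · exact zero_le
  · push Not at hx
    refine le_add_left ?_
    calc _ ≤ expWeight r x * _ := by
          gcongr
          exact measure_eq_le_sum_neighbors hF hn hy x
      _ = ∑ w ∈ (Finset.Icc (x - 1) (x + 1)).filter (fun w => ‖emb w - emb x‖ = 1),
            expWeight r x * P ({ω | w ∈ F n ω} ∩ {ω | y ω = x}) := Finset.mul_sum _ _ _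
      _ ≤ ∑ w ∈ (Finset.Icc (x - 1) (x + 1)).filter (fun w => ‖emb w - emb x‖ = 1),
            ENNReal.ofReal (Real.exp 1) * ENNReal.ofReal (C / r) *
              (expWeight r w * P {ω | w ∈ F n ω}) := by
          refine Finset.sum_le_sum fun w hw => ?_
          have hwx := (Finset.mem_filter.1 hw).2
          have h1 : ‖emb x‖ ≤ ‖emb w‖ + 1 := by
            have := norm_sub_norm_le (emb x) (emb w)
            rw [norm_sub_rev, hwx] at this
            linarith
          have h2 : expWeight r x ≤ ENNReal.ofReal (Real.exp 1) * expWeight r w := by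
            rw [expWeight, expWeight, if_pos (by linarith), if_pos (by linarith),
              ← ENNReal.ofReal_mul (Real.exp_pos 1).le, ← Real.exp_add]
            exact ENNReal.ofReal_le_ofReal (Real.exp_le_exp.2 (by linarith))
          calc _ ≤ (ENNReal.ofReal (Real.exp 1) * expWeight r w) *
                (ENNReal.ofReal (C / r) * P {ω | w ∈ F n ω}) :=
                mul_le_mul' h2 (measure_mem_inter_le hF hC hr hn hy (by linarith) x)
            _ = _ := by ring
      -- Summing over the whole cube instead of the neighbours costs only a factor in $d$, and makes
      -- the later double sum easy to exchange.
      _ ≤ _ := Finset.sum_le_sum_of_subset (Finset.filter_subset _ _)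

theorem tsum_sum_neighbors (f : Lattice d → ℝ≥0∞) :
    ∑' x, ∑ w ∈ Finset.Icc (x - 1) (x + 1), f w = 3 ^ d * ∑' w, f w := by
  have h1 : ∀ x : Lattice d, ∑ w ∈ Finset.Icc (x - 1) (x + 1), f w =
      ∑' w, if w ∈ Finset.Icc (x - 1) (x + 1) then f w else 0 := fun x => by
    rw [tsum_eq_sum (s := Finset.Icc (x - 1) (x + 1)) fun w hw => if_neg hw]
    exact Finset.sum_congr rfl fun w hw => (if_pos hw).symm
  have h2 : ∀ w : Lattice d, ∑' x, (if w ∈ Finset.Icc (x - 1) (x + 1) then f w else 0) =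
      3 ^ d * f w := fun w => by
    have hiff : ∀ x, w ∈ Finset.Icc (x - 1) (x + 1) ↔ x ∈ Finset.Icc (w - 1) (w + 1) := fun x => by
      rw [Finset.mem_Icc, Finset.mem_Icc, sub_le_iff_le_add, sub_le_iff_le_add, and_comm]
    simp_rw [hiff]
    rw [tsum_eq_sum (s := Finset.Icc (w - 1) (w + 1)) fun x hx => if_neg hx,
      Finset.sum_congr rfl fun x hx => if_pos hx, Finset.sum_const, card_Icc_sub_one_add_one,
      nsmul_eq_mul]
    push_cast
    rfl
  simp_rw [h1]
  rw [ENNReal.tsum_comm]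
  simp_rw [h2]
  exact ENNReal.tsum_mul_left

/-- Summing the pointwise bound over `x`, the near points contribute at most $e$ in total since the
new point has total mass one, and each old point is charged by $3^d$ cubes. -/
theorem expectedWeight_succ_le (hF : IsBallisticAggregation P F)
    (hC : ∀ A : Finset (Lattice d), Cluster A → ∀ x ∈ A, ∀ r : ℝ, 0 < r → r ≤ ‖emb x‖ →
      ∀ z, ballisticMeasure (outerBoundary A) z ≤ ENNReal.ofReal (C / r))
    (hr : 0 < r) (hn : 1 ≤ n) :
    expectedWeight P r (F (n + 1)) ≤
      (1 + 3 ^ d * (ENNReal.ofReal (Real.exp 1) * ENNReal.ofReal (C / r))) *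
        expectedWeight P r (F n) + ENNReal.ofReal (Real.exp 1) := by
  obtain ⟨y, hym, hFy, hy⟩ := hF.step n hn
  have hone : ∑' x, P {ω | y ω = x} = 1 := by
    rw [← measure_univ (μ := P), ← measure_iUnion (f := fun x => {ω | y ω = x})
      (fun a b hab => Set.disjoint_left.2 fun ω ha hb => hab (Eq.trans (Eq.symm ha) hb))
      fun x => hym (measurableSet_singleton x)]
    congr 1
    ext ω
    simp
  have hmem : ∀ x, P {ω | x ∈ F (n + 1) ω} ≤ P {ω | x ∈ F n ω} + P {ω | y ω = x} := fun x => by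
    refine (measure_mono fun ω hω => ?_).trans (measure_union_le _ _)
    have h : x ∈ F (n + 1) ω := hω
    rw [hFy, Finset.mem_union, Finset.mem_singleton] at h
    exact h.imp id Eq.symm
  calc expectedWeight P r (F (n + 1))
      ≤ ∑' x, (expWeight r x * P {ω | x ∈ F n ω} + (ENNReal.ofReal (Real.exp 1) * P {ω | y ω = x} +
          ∑ w ∈ Finset.Icc (x - 1) (x + 1), ENNReal.ofReal (Real.exp 1) * ENNReal.ofReal (C / r) *
            (expWeight r w * P {ω | w ∈ F n ω}))) := by
        refine ENNReal.tsum_le_tsum fun x => ?_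
        calc _ ≤ expWeight r x * (P {ω | x ∈ F n ω} + P {ω | y ω = x}) := by
              gcongr
              exact hmem x
          _ ≤ _ := by
              rw [mul_add]
              gcongr
              exact expWeight_mul_measure_le hF hC hr hn hy x
    _ = _ := by
        rw [ENNReal.tsum_add, ENNReal.tsum_add, ENNReal.tsum_mul_left, hone, tsum_sum_neighbors,
          ENNReal.tsum_mul_left, expectedWeight]
        ring

theorem expectedWeight_le (hF : IsBallisticAggregation P F) (hC0 : 0 ≤ C)
    (hC : ∀ A : Finset (Lattice d), Cluster A → ∀ x ∈ A, ∀ r : ℝ, 0 < r → r ≤ ‖emb x‖ →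
      ∀ z, ballisticMeasure (outerBoundary A) z ≤ ENNReal.ofReal (C / r))
    (hr : 0 < r) (hn : 1 ≤ n) :
    expectedWeight P r (F n) ≤
      ENNReal.ofReal (n * Real.exp 1 * Real.exp (n * (3 ^ d * Real.exp 1 * C / r))) := by
  set Q := 3 ^ d * Real.exp 1 * C / r with hQ
  have hQ0 : 0 ≤ Q := by positivity
  -- Iteration of the recursion from weight zero: each of fewer than `n` additive terms $e$ is
  -- amplified by at most $(1+Q)^n$.
  suffices h : expectedWeight P r (F n) ≤ ENNReal.ofReal (n * Real.exp 1 * (1 + Q) ^ n) by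
    refine h.trans (ENNReal.ofReal_le_ofReal ?_)
    gcongr
    rw [Real.exp_nat_mul]
    gcongr
    rw [add_comm]
    exact Real.add_one_le_exp Q
  induction n, hn using Nat.le_induction with
  | base =>
    have h0 : expectedWeight P r (F 1) = 0 := by
      refine ENNReal.tsum_eq_zero.2 fun x => ?_
      by_cases hx : x = 0
      · subst hx
        rw [expWeight, emb_zero, norm_zero, if_neg hr.not_gt, zero_mul]
      · simp [hF.start, hx]
    rw [h0]
    exact zero_le
  | succ n hn ih =>
    refine (expectedWeight_succ_le hF hC hr hn).trans ?_
    have hcoef : 1 + 3 ^ d * (ENNReal.ofReal (Real.exp 1) * ENNReal.ofReal (C / r)) =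
        ENNReal.ofReal (1 + Q) := by
      rw [ENNReal.ofReal_add zero_le_one hQ0, ENNReal.ofReal_one,
        ← ENNReal.ofReal_mul (Real.exp_pos 1).le, hQ,
        show 3 ^ d * Real.exp 1 * C / r = 3 ^ d * (Real.exp 1 * (C / r)) by ring,
        ENNReal.ofReal_mul (p := 3 ^ d) (by positivity), ENNReal.ofReal_pow (by norm_num),
        ENNReal.ofReal_ofNat]
    rw [hcoef]
    calc _ ≤ ENNReal.ofReal (1 + Q) * ENNReal.ofReal (n * Real.exp 1 * (1 + Q) ^ n) +
          ENNReal.ofReal (Real.exp 1) := by gcongr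
      _ = ENNReal.ofReal ((1 + Q) * (n * Real.exp 1 * (1 + Q) ^ n) + Real.exp 1) := by
          rw [← ENNReal.ofReal_mul (by positivity), ← ENNReal.ofReal_add (by positivity)
            (Real.exp_pos 1).le]
      _ ≤ _ := by
          refine ENNReal.ofReal_le_ofReal ?_
          have h1 : 1 ≤ (1 + Q) ^ (n + 1) := one_le_pow₀ (by linarith)
          have h2 := mul_le_mul_of_nonneg_left h1 (Real.exp_pos 1).le
          push_cast
          rw [pow_succ] at h2 ⊢
          linarith

end Growth

/-! ### Tail bound for the radius and Borel–Cantelli -/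

theorem rad_le_iff {d : ℕ} (A : Finset (Lattice d)) {t : ℝ} (ht : 0 ≤ t) :
    rad A ≤ t ↔ ∀ x ∈ A, ‖emb x‖ ≤ t := by
  lift t to ℝ≥0 using ht
  rw [rad, NNReal.coe_le_coe, Finset.sup_le_iff]
  rfl

/-- Markov's inequality in the form of a union bound: every point beyond $2r$ has weight at least
$e^r$. -/
theorem measure_rad_gt_le {d : ℕ} {Ω : Type*} [MeasurableSpace Ω] (P : Measure Ω)
    (F : Ω → Finset (Lattice d)) {r : ℝ} (hr : 0 < r) :
    P {ω | 2 * r < rad (F ω)} ≤ ENNReal.ofReal (Real.exp (-r)) * expectedWeight P r F := by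
  have hsub : {ω | 2 * r < rad (F ω)} ⊆
      ⋃ x : {x : Lattice d // 2 * r < ‖emb x‖}, {ω | (x : Lattice d) ∈ F ω} := by
    intro ω hω
    have h : ¬ rad (F ω) ≤ 2 * r := not_le.2 hω
    rw [rad_le_iff _ (by positivity)] at h
    push Not at h
    obtain ⟨x, hx, hxr⟩ := h
    exact mem_iUnion.2 ⟨⟨x, hxr⟩, hx⟩
  refine (measure_mono hsub).trans ((measure_iUnion_le _).trans ?_)
  rw [expectedWeight, ← ENNReal.tsum_mul_left]
  refine le_trans (ENNReal.tsum_le_tsum fun x => ?_) (ENNReal.tsum_comp_le_tsum_of_injective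
    (f := ((↑) : {x : Lattice d // 2 * r < ‖emb x‖} → Lattice d)) Subtype.val_injective _)
  rw [← mul_assoc, expWeight, if_pos (by linarith [x.2]), ← ENNReal.ofReal_mul (Real.exp_pos _).le,
    ← Real.exp_add]
  refine le_mul_of_one_le_left zero_le ?_
  rw [← ENNReal.ofReal_one]
  exact ENNReal.ofReal_le_ofReal (Real.one_le_exp (by linarith [x.2]))

/-- From $t^6/6!\le e^t$ at $t=\sqrt n$, the power six being the one that leaves a summable
$n^{-2}$. -/
theorem nat_mul_exp_neg_sqrt_le (n : ℕ) : (n : ℝ) * Real.exp (-√n) ≤ 720 * (1 / (n : ℝ) ^ 2) := by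
  rcases Nat.eq_zero_or_pos n with rfl | hn
  · simp
  have hn' : (0 : ℝ) < n := by exact_mod_cast hn
  have h := Real.pow_div_factorial_le_exp (√n) (Real.sqrt_nonneg _) 6
  have h6 : √(n : ℝ) ^ 6 = (n : ℝ) ^ 3 := by
    rw [show (6 : ℕ) = 2 * 3 by norm_num, pow_mul, Real.sq_sqrt hn'.le]
  rw [h6, show ((Nat.factorial 6 : ℕ) : ℝ) = 720 by norm_num [Nat.factorial]] at h
  rw [Real.exp_neg, ← div_eq_mul_inv, div_le_iff₀ (Real.exp_pos _)]
  calc (n : ℝ) = 720 * (1 / (n : ℝ) ^ 2) * ((n : ℝ) ^ 3 / 720) := by field_simp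
    _ ≤ _ := by gcongr

end BallisticAggregation

open BallisticAggregation in
theorem mainTheorem1 (d : ℕ) (hd : 2 ≤ d) :
    ∃ c : ℝ, 0 < c ∧
      ∀ (Ω : Type*) [MeasurableSpace Ω] (P : MeasureTheory.Measure Ω)
        [MeasureTheory.IsProbabilityMeasure P]
        (F : ℕ → Ω → Finset (BallisticAggregation.Lattice d)),
        BallisticAggregation.IsBallisticAggregation P F →
          ∀ᵐ ω ∂P, ∀ᶠ n : ℕ in Filter.atTop,
            BallisticAggregation.rad (F n ω) ≤ c * (n : ℝ) ^ (1 / 2 : ℝ) := by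
  obtain ⟨C, hC0, hC⟩ := exists_ballisticMeasure_le hd
  set K := 3 ^ d * Real.exp 1 * C with hK
  have hK0 : 0 ≤ K := by positivity
  -- The radius is $r=(K+2)\sqrt n$: the growth exponent $nK/r$ is then at most $\sqrt n$, while
  -- $r\ge2\sqrt n$, which leaves a factor $e^{-\sqrt n}$.
  refine ⟨2 * (K + 2), by positivity, fun Ω _ P _ F hF => ?_⟩
  have hbound : ∀ n : ℕ, 1 ≤ n → P {ω | 2 * ((K + 2) * √n) < rad (F n ω)} ≤
      ENNReal.ofReal (Real.exp 1 * 720 * (1 / (n : ℝ) ^ 2)) := by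
    intro n hn
    have hs : 0 < √(n : ℝ) := Real.sqrt_pos.2 (by exact_mod_cast hn)
    have hss : √(n : ℝ) * √n = n := Real.mul_self_sqrt n.cast_nonneg
    have hr : 0 < (K + 2) * √n := by positivity
    calc _ ≤ _ := measure_rad_gt_le P (F n) hr
      _ ≤ _ := mul_le_mul_right (expectedWeight_le hF hC0 hC hr hn) _
      _ ≤ _ := by
          rw [← hK, ← ENNReal.ofReal_mul (Real.exp_pos _).le]
          refine ENNReal.ofReal_le_ofReal ?_
          have h1 : (n : ℝ) * (K / ((K + 2) * √n)) ≤ √n := by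
            rw [mul_div_assoc', div_le_iff₀ hr]
            nlinarith
          calc _ = Real.exp 1 * (n * Real.exp (-((K + 2) * √n) + n * (K / ((K + 2) * √n)))) := by
                rw [Real.exp_add]
                ring
            _ ≤ Real.exp 1 * (n * Real.exp (-√n)) := by
                gcongr
                nlinarith
            _ ≤ Real.exp 1 * (720 * (1 / (n : ℝ) ^ 2)) :=
                mul_le_mul_of_nonneg_left (nat_mul_exp_neg_sqrt_le n) (Real.exp_pos 1).le
            _ = _ := by ring
  -- The condition $1\le n$ is part of the event because `F 0` is arbitrary.
  have hsum : ∑' n : ℕ, P {ω | 1 ≤ n ∧ 2 * ((K + 2) * √n) < rad (F n ω)} ≠ ⊤ := by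
    have hs : Summable fun n : ℕ => Real.exp 1 * 720 * (1 / (n : ℝ) ^ 2) :=
      (Real.summable_one_div_nat_pow.2 one_lt_two).mul_left _
    refine ne_top_of_le_ne_top hs.tsum_ofReal_ne_top (ENNReal.tsum_le_tsum fun n => ?_)
    by_cases hn : 1 ≤ n
    · simpa only [hn, true_and] using hbound n hn
    · simp [hn]
  filter_upwards [ae_eventually_notMem hsum] with ω hω
  filter_upwards [hω, Filter.eventually_ge_atTop 1] with n hn hn1
  have h : ¬ 2 * ((K + 2) * √n) < rad (F n ω) := fun h => hn ⟨hn1, h⟩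
  rw [← Real.sqrt_eq_rpow]
  linarith
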